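/- Let $A$ be a finite partially ordered alphabet with an order-preserving involution $a\mapsto\bar a$. Order $A^*$ by the Higman ordering: $a_0\cdots a_{n-1}\le b_0\cdots b_{m-1}$ iff there is a strictly increasing map $h:\{0,\dots,n-1\}\to\{0,\dots,m-1\}$ with $a_i\le b_{h(i)}$ for all $i$. A final segment of $A^*$ is a language $F\subseteq A^*$ such that $\alpha\in F$ and $\alpha\le\beta$ imply $\beta\in F$; $F_1F_2$ denotes concatenation of languages. An automaton with initial state $x$ and final state $y$ is a triple $\mathcal A=(M,\{x\},\{y\})$ where $M=(Q,T)$ is a transition system, $T\subseteq Q\times A\times Q$ and $x,y\in Q$; it accepts the language of all labels of paths from $x$ to $y$ (the null path at a state has the empty word as label). It is reflexive and involutive if for all $p,q\in Q$ and $a,b\in A$ with $a\le b$: $(p,a,p)\in T$; $(p,a,q)\in T$ implies $(q,\bar a,p)\in T$; $(p,a,q)\in T$ implies $(p,b,q)\in T$. Such an automaton $\mathcal A$ is minmax if it is reflexive and involutive and, for every reflexive and involutive automaton $\mathcal A'=((Q',T'),\{x'\},\{y'\})$ accepting the same language as $\mathcal A$, one has $|Q|\le|Q'|$, and $|Q|=|Q'|$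 implies $|T|\ge|T'|$. If $\mathcal A_1=((Q_1,T_1),\{x\},\{z\})$ and $\mathcal A_2=((Q_2,T_2),\{z\},\{y\})$ are automata with $Q_1\cap Q_2=\{z\}$, their concatenation is $\mathcal A_1\cdot\mathcal A_2:=((Q_1\cup Q_2,\,T_1\cup T_2),\{x\},\{y\})$. Theorem. Let $F$ be a non-empty final segment of $A^*$ with $F=F_1F_2$, where $F_1$ and $F_2$ are final segments of $A^*$. Let $\mathcal A$ be an automaton with initial state $x$ and final state $y$ accepting $F$. Then $\mathcal A$ is minmax if and only if there are a state $z$ and minmax automata $\mathcal A_1=((Q_1,T_1),\{x\},\{z\})$ accepting $F_1$ and $\mathcal A_2=((Q_2,T_2),\{z\},\{y\})$ accepting $F_2$, with $Q_1\cap Q_2=\{z\}$, such that $\mathcal A=\mathcal A_1\cdot\mathcal A_2$. -/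

import Mathlib

universe u v

/-- `F` is a final segment of `A*` for the Higman ordering: `α ≤ β` means that there is a strictly
increasing map `h` from the positions of `α` to those of `β` with `αᵢ ≤ β_{h i}` for every `i`,
which is Mathlib's `List.SublistForall₂ (· ≤ ·) α β`. -/
def IsFinalSegment {A : Type v} [PartialOrder A] (F : Language A) : Prop :=
  ∀ α β : List A, List.SublistForall₂ (· ≤ ·) α β → α ∈ F → β ∈ F

/-- A transition system on the alphabet `A`: a set of states (elements of an ambient type `Ω`, so
that two systems may have states in common) and a set of transitions between states. -/
structure TransitionSystem (A : Type v) (Ω : Type u) where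
  states : Set Ω
  trans : Set (Ω × A × Ω)
  src_mem : ∀ p a q, (p, a, q) ∈ trans → p ∈ states
  tgt_mem : ∀ p a q, (p, a, q) ∈ trans → q ∈ states

namespace TransitionSystem

variable {A : Type v} {Ω : Type u}

/-- `M.HasPath p w q`: there is a path of label `w`, origin `p` and end `q`. -/
inductive HasPath (M : TransitionSystem A Ω) : Ω → List A → Ω → Prop
  | nil (q : Ω) (hq : q ∈ M.states) : HasPath M q [] q
  | cons (p : Ω) (a : A) (q : Ω) (w : List A) (r : Ω)
      (h : (p, a, q) ∈ M.trans) (hw : HasPath M q w r) : HasPath M p (a :: w) r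

/-- Reflexive and involutive transition systems over an ordered alphabet with involution `bar`. -/
structure IsReflexiveInvolutive [PartialOrder A] (bar : A → A) (M : TransitionSystem A Ω) :
    Prop where
  loop : ∀ p ∈ M.states, ∀ a : A, (p, a, p) ∈ M.trans
  reverse : ∀ p a q, (p, a, q) ∈ M.trans → (q, bar a, p) ∈ M.trans
  up : ∀ p a b q, a ≤ b → (p, a, q) ∈ M.trans → (p, b, q) ∈ M.trans

end TransitionSystem

/-- An automaton: a transition system with a set of initial and a set of final states. -/
@[ext]
structure FSAutomaton (A : Type v) (Ω : Type u) extends TransitionSystem A Ω where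
  initial : Set Ω
  final : Set Ω
  initial_subset : initial ⊆ states
  final_subset : final ⊆ states

namespace FSAutomaton

variable {A : Type v} {Ω : Type u}

/-- The language of all labels of successful paths. -/
def language (𝒜 : FSAutomaton A Ω) : Language A :=
  {w | ∃ p ∈ 𝒜.initial, ∃ q ∈ 𝒜.final, 𝒜.HasPath p w q}

/-- An automaton `(M, {x}, {y})` is minmax if it is reflexive and involutive and, among all
reflexive and involutive automata with one initial and one final state that accept the same
language, it has the least number of states and, among those with that number of states, the
largest number of transitions. -/
structure IsMinmax [PartialOrder A] (bar : A → A) (𝒜 : FSAutomaton A Ω) : Prop where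
  exists_initial : ∃ x, 𝒜.initial = {x}
  exists_final : ∃ y, 𝒜.final = {y}
  refl_inv : 𝒜.IsReflexiveInvolutive bar
  states_le : ∀ (Ω' : Type u) (ℬ : FSAutomaton A Ω') (x' y' : Ω'),
    ℬ.initial = {x'} → ℬ.final = {y'} → ℬ.IsReflexiveInvolutive bar →
    ℬ.language = 𝒜.language → Cardinal.mk 𝒜.states ≤ Cardinal.mk ℬ.states
  trans_ge : ∀ (Ω' : Type u) (ℬ : FSAutomaton A Ω') (x' y' : Ω'),
    ℬ.initial = {x'} → ℬ.final = {y'} → ℬ.IsReflexiveInvolutive bar →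
    ℬ.language = 𝒜.language → Cardinal.mk 𝒜.states = Cardinal.mk ℬ.states →
    Cardinal.mk ℬ.trans ≤ Cardinal.mk 𝒜.trans

/-- The concatenation `𝒜₁ · 𝒜₂`: union of the states and of the transitions. It is meant for
automata `𝒜₁ = (M₁, {x}, {z})` and `𝒜₂ = (M₂, {z}, {y})` whose only common state is `z`. -/
def concat (𝒜₁ 𝒜₂ : FSAutomaton A Ω) : FSAutomaton A Ω where
  states := 𝒜₁.states ∪ 𝒜₂.states
  trans := 𝒜₁.trans ∪ 𝒜₂.trans
  src_mem p a q h := h.imp (𝒜₁.src_mem p a q) (𝒜₂.src_mem p a q)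
  tgt_mem p a q h := h.imp (𝒜₁.tgt_mem p a q) (𝒜₂.tgt_mem p a q)
  initial := 𝒜₁.initial
  final := 𝒜₂.final
  initial_subset _ h := Or.inl (𝒜₁.initial_subset h)
  final_subset _ h := Or.inr (𝒜₂.final_subset h)

end FSAutomaton

/-! Let `ℬ` be reflexive and involutive, accepting `F₁ * F₂` from `x` to `y`. Let `X` be the set of
states reached from `x` by some word outside `F₁`, and `Y` the set of states from which some word
outside `F₂` leads to `y`. A word `u a v` of `F₁ * F₂` has `u ∈ F₁` or `v ∈ F₂`
(`prefix_or_suffix_of_cons`), so no transition joins `X` to `Y`, and `X`, `Y` are disjoint. Every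
accepting path therefore meets a state outside `X ∪ Y`. Collapsing the complement of `X`,
respectively of `Y`, to one such state `z` gives automata accepting exactly `F₁` and `F₂`. Together
they have `|X| + |Y| + 1` states, at most as many as `ℬ`; if they use all states of `ℬ`, then `ℬ` is
their concatenation (`exists_decomposition`).

Concatenation adds numbers of states up to the constant 1 and numbers of transitions up to `|A|`
(`mk_states_concat`, `mk_trans_concat`), so minmaxness passes between the factors and the product.
The cancellations need finite automata; these come from Higman's lemma, by which a final segment has
finitely many residuals. -/

/-! ### Final segments of the free monoid -/

section Words

variable {A : Type v}

/-- The left residual `u⁻¹F`. -/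
def leftResidual (F : Language A) (u : List A) : Language A := {v | u ++ v ∈ F}

/-- Multiply a word `w` of `F₁` by a shortest word of `F₂`. In a factorization of the result in `L₁
* L₂` the right factor is at least as long, so the left one is a prefix of `w`, and `L₁` is stable
under right extension. The other side is symmetric. -/
theorem Language.eq_of_le_of_mul_le {F₁ F₂ L₁ L₂ : Language A}
    (hF₁ : ∃ w, w ∈ F₁) (hF₂ : ∃ w, w ∈ F₂)
    (hL₁ : ∀ u v, u ∈ L₁ → u ++ v ∈ L₁) (hL₂ : ∀ u v, v ∈ L₂ → u ++ v ∈ L₂)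
    (h₁ : ∀ w ∈ L₁, w ∈ F₁) (h₂ : ∀ w ∈ L₂, w ∈ F₂) (h : ∀ w ∈ F₁ * F₂, w ∈ L₁ * L₂) :
    L₁ = F₁ ∧ L₂ = F₂ := by
  have hmin : ∀ F : Language A, (∃ w, w ∈ F) → ∃ w ∈ F, ∀ w' ∈ F, w.length ≤ w'.length := by
    intro F hF
    obtain ⟨w, hw, hm⟩ := WellFounded.has_min (measure (List.length (α := A))).wf {w | w ∈ F} hF
    exact ⟨w, hw, fun w' hw' => not_lt.1 (hm w' hw')⟩
  obtain ⟨m₁, hm₁, hmin₁⟩ := hmin F₁ hF₁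
  obtain ⟨m₂, hm₂, hmin₂⟩ := hmin F₂ hF₂
  constructor
  · ext w
    refine ⟨h₁ w, fun hw => ?_⟩
    obtain ⟨u, hu, v, hv, e⟩ := Language.mem_mul.1 (h _ (Language.append_mem_mul hw hm₂))
    have hlen := hmin₂ v (h₂ v hv)
    rcases List.append_eq_append_iff.1 e with ⟨s, rfl, rfl⟩ | ⟨s, rfl, rfl⟩
    · exact hL₁ u s hu
    · obtain rfl : s = [] := List.eq_nil_of_length_eq_zero (by simp at hlen; simpa using hlen)
      simpa using hu
  · ext w
    refine ⟨h₂ w, fun hw => ?_⟩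
    obtain ⟨u, hu, v, hv, e⟩ := Language.mem_mul.1 (h _ (Language.append_mem_mul hm₁ hw))
    have hlen := hmin₁ u (h₁ u hu)
    rcases List.append_eq_append_iff.1 e with ⟨s, rfl, rfl⟩ | ⟨s, rfl, rfl⟩
    · obtain rfl : s = [] := List.eq_nil_of_length_eq_zero (by simp at hlen; simpa using hlen)
      simpa using hv
    · exact hL₂ s v hv

variable [PartialOrder A]

theorem List.SublistForall₂.append {l₁ l₂ m₁ m₂ : List A}
    (h : SublistForall₂ (· ≤ ·) l₁ m₁) (h' : SublistForall₂ (· ≤ ·) l₂ m₂) :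
    SublistForall₂ (· ≤ ·) (l₁ ++ l₂) (m₁ ++ m₂) := by
  obtain ⟨k, hk, hs⟩ := sublistForall₂_iff.1 h
  obtain ⟨k', hk', hs'⟩ := sublistForall₂_iff.1 h'
  exact sublistForall₂_iff.2 ⟨k ++ k', rel_append hk hk', hs.append hs'⟩

theorem List.SublistForall₂.exists_append {l m₁ m₂ : List A}
    (h : SublistForall₂ (· ≤ ·) l (m₁ ++ m₂)) :
    ∃ l₁ l₂, l = l₁ ++ l₂ ∧ SublistForall₂ (· ≤ ·) l₁ m₁ ∧ SublistForall₂ (· ≤ ·) l₂ m₂ := by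
  obtain ⟨k, hk, hs⟩ := sublistForall₂_iff.1 h
  obtain ⟨k₁, k₂, rfl, h₁, h₂⟩ := sublist_append_iff.1 hs
  exact ⟨_, _, (take_append_drop k₁.length l).symm,
    sublistForall₂_iff.2 ⟨k₁, forall₂_take_append l k₁ k₂ hk, h₁⟩,
    sublistForall₂_iff.2 ⟨k₂, forall₂_drop_append l k₁ k₂ hk, h₂⟩⟩

namespace IsFinalSegment

variable {F F₁ F₂ : Language A}

theorem sublist (hF : IsFinalSegment F) {u w : List A} (h : u.Sublist w) (hu : u ∈ F) : w ∈ F :=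
  hF u w h.sublistForall₂ hu

theorem append_right (hF : IsFinalSegment F) {u : List A} (v : List A) (hu : u ∈ F) : u ++ v ∈ F :=
  hF.sublist (List.sublist_append_left u v) hu

theorem append_left (hF : IsFinalSegment F) {v : List A} (u : List A) (hv : v ∈ F) : u ++ v ∈ F :=
  hF.sublist (List.sublist_append_right u v) hv

theorem prefix_or_suffix (h₁ : IsFinalSegment F₁) (h₂ : IsFinalSegment F₂) {u v : List A}
    (h : u ++ v ∈ F₁ * F₂) : u ∈ F₁ ∨ v ∈ F₂ := by
  obtain ⟨u', hu', v', hv', e⟩ := Language.mem_mul.1 h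
  rcases List.append_eq_append_iff.1 e with ⟨s, rfl, rfl⟩ | ⟨s, rfl, rfl⟩
  · exact Or.inl (h₁.append_right s hu')
  · exact Or.inr (h₂.append_left s hv')

/-- A factorization cuts the word before or after the letter `a`, so `a` is needed on neither side.
This is what forbids transitions from `X` to `Y`. -/
theorem prefix_or_suffix_of_cons (h₁ : IsFinalSegment F₁) (h₂ : IsFinalSegment F₂)
    {u v : List A} {a : A} (h : u ++ a :: v ∈ F₁ * F₂) : u ∈ F₁ ∨ v ∈ F₂ := by
  obtain ⟨u', hu', v', hv', e⟩ := Language.mem_mul.1 h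
  rcases List.append_eq_append_iff.1 e with ⟨s, rfl, rfl⟩ | ⟨s, rfl, hs⟩
  · exact Or.inl (h₁.append_right s hu')
  · cases s with
    | nil => exact Or.inl (by simpa using hu')
    | cons b s =>
      obtain ⟨-, rfl⟩ := List.cons_eq_cons.1 hs
      exact Or.inr (h₂.append_left s hv')

/-- Otherwise words of `F` could be chosen one by one, none above an earlier one, against Higman's
lemma. -/
theorem exists_finset_generators [Finite A] (F : Language A) :
    ∃ s : Finset (List A), (∀ g ∈ s, g ∈ F) ∧
      ∀ w ∈ F, ∃ g ∈ s, List.SublistForall₂ (· ≤ ·) g w := by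
  by_contra! hcon
  obtain ⟨f, -, hf⟩ := exists_seq_of_forall_finset_exists (· ∈ F)
    (fun g w => ¬ List.SublistForall₂ (· ≤ ·) g w) hcon
  have hpwo := (Set.finite_univ (α := A)).partiallyWellOrderedOn (r := (· ≤ ·))
    |>.partiallyWellOrderedOn_sublistForall₂ (· ≤ ·)
  obtain ⟨m, n, hmn, h⟩ := hpwo.exists_lt (f := f) (by simp)
  exact hf m n hmn h

theorem leftResidual (hF : IsFinalSegment F) (u : List A) : IsFinalSegment (leftResidual F u) :=
  fun v w hvw hv => hF (u ++ v) (u ++ w)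
    ((List.Sublist.refl u).sublistForall₂.append hvw) hv

/-- If a generator `g` lies below `u ++ v`, then `g = p ++ t` with `p ≤ u` and `t ≤ v`. So each
residual is generated by suffixes of the finitely many generators. -/
theorem finite_range_leftResidual [Finite A] (hF : IsFinalSegment F) :
    (Set.range (_root_.leftResidual F)).Finite := by
  obtain ⟨s, hsF, hs⟩ := exists_finset_generators F
  have hfin : (⋃ g ∈ s, {v | v <:+ g}).Finite :=
    s.finite_toSet.biUnion fun g _ => by
      simpa [List.mem_tails] using g.tails.finite_toSet
  refine (hfin.powerset.image fun S : Set (List A) =>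
    ({v | ∃ t ∈ S, List.SublistForall₂ (· ≤ ·) t v} : Language A)).subset ?_
  rintro _ ⟨u, rfl⟩
  refine ⟨{t | t ∈ _root_.leftResidual F u ∧ ∃ g ∈ s, t <:+ g}, ?_, ?_⟩
  · rintro t ⟨-, g, hg, ht⟩
    simp only [Set.mem_iUnion]
    exact ⟨g, hg, ht⟩
  · ext v
    constructor
    · rintro ⟨t, ⟨ht, -⟩, htv⟩
      exact hF.leftResidual u t v htv ht
    · intro hv
      obtain ⟨g, hg, hgv⟩ := hs _ hv
      obtain ⟨p, t, rfl, hp, ht⟩ := hgv.exists_append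
      exact ⟨t, ⟨hF _ _ (hp.append (List.Sublist.refl t).sublistForall₂) (hsF _ hg),
        _, hg, List.suffix_append p t⟩, ht⟩

end IsFinalSegment

end Words

/-! ### Paths and constructions on automata -/

namespace TransitionSystem

variable {A : Type v} {Ω Ω' : Type u}

namespace HasPath

variable {M : TransitionSystem A Ω} {p q r : Ω} {w w' : List A} {a : A}

theorem src_mem (h : M.HasPath p w q) : p ∈ M.states := by
  cases h with
  | nil _ hq => exact hq
  | cons _ a q w r h _ => exact M.src_mem _ _ _ h

theorem tgt_mem (h : M.HasPath p w q) : q ∈ M.states := by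
  induction h with
  | nil _ hq => exact hq
  | cons _ _ _ _ _ _ _ ih => exact ih

theorem append (h : M.HasPath p w q) (h' : M.HasPath q w' r) : M.HasPath p (w ++ w') r := by
  induction h with
  | nil => exact h'
  | cons p a q w r h _ ih => exact .cons p a q _ _ h (ih h')

theorem single (h : (p, a, q) ∈ M.trans) : M.HasPath p [a] q :=
  .cons _ _ _ _ _ h (.nil _ (M.tgt_mem _ _ _ h))

theorem map {M' : TransitionSystem A Ω'} (f : Ω → Ω') (hs : ∀ p ∈ M.states, f p ∈ M'.states)
    (ht : ∀ p a q, (p, a, q) ∈ M.trans → (f p, a, f q) ∈ M'.trans) (h : M.HasPath p w q) :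
    M'.HasPath (f p) w (f q) := by
  induction h with
  | nil q hq => exact .nil _ (hs q hq)
  | cons p a q w r h _ ih => exact .cons _ _ _ _ _ (ht _ _ _ h) ih

/-- If no transition goes from `X` to `Y`, a path from outside `Y` to outside `X` meets a state
that is neither in `X` nor in `Y`. -/
theorem exists_split {X Y : Set Ω} (hXY : ∀ p a q, (p, a, q) ∈ M.trans → p ∈ X → q ∉ Y)
    (h : M.HasPath p w q) (hp : p ∉ Y) (hq : q ∉ X) :
    ∃ u v r, w = u ++ v ∧ r ∈ M.states ∧ r ∉ X ∧ r ∉ Y ∧ M.HasPath p u r ∧ M.HasPath r v q := by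
  induction h with
  | nil q hqs => exact ⟨[], [], q, rfl, hqs, hq, hp, .nil q hqs, .nil q hqs⟩
  | cons p a q w r h hw ih =>
    by_cases hpX : p ∈ X
    · obtain ⟨u, v, s, rfl, hs, hsX, hsY, h₁, h₂⟩ := ih (hXY _ _ _ h hpX) hq
      exact ⟨a :: u, v, s, rfl, hs, hsX, hsY, .cons _ _ _ _ _ h h₁, h₂⟩
    · have hps := M.src_mem _ _ _ h
      exact ⟨[], _, p, rfl, hps, hpX, hp, .nil p hps, .cons _ _ _ _ _ h hw⟩

end HasPath

namespace IsReflexiveInvolutive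

variable [PartialOrder A] {bar : A → A} {M : TransitionSystem A Ω}

theorem loops (hM : M.IsReflexiveInvolutive bar) {p : Ω} (hp : p ∈ M.states) (w : List A) :
    M.HasPath p w p := by
  induction w with
  | nil => exact .nil p hp
  | cons a w ih => exact .cons _ _ _ _ _ (hM.loop p hp a) ih

end IsReflexiveInvolutive

end TransitionSystem

namespace FSAutomaton

open TransitionSystem

variable {A : Type v} {Ω Ω' : Type u}

theorem mem_language_iff {𝒜 : FSAutomaton A Ω} {x y : Ω} (hx : 𝒜.initial = {x})
    (hy : 𝒜.final = {y}) {w : List A} : w ∈ 𝒜.language ↔ 𝒜.HasPath x w y := by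
  change (∃ p ∈ 𝒜.initial, ∃ q ∈ 𝒜.final, 𝒜.HasPath p w q) ↔ _
  simp [hx, hy]

/-- The image of an automaton under a map of the states. -/
def map (f : Ω → Ω') (𝒜 : FSAutomaton A Ω) : FSAutomaton A Ω' where
  states := f '' 𝒜.states
  trans := Prod.map f (Prod.map id f) '' 𝒜.trans
  src_mem := by
    rintro _ _ _ ⟨⟨p, a, q⟩, h, e⟩
    exact ⟨p, 𝒜.src_mem _ _ _ h, (Prod.ext_iff.1 e).1⟩
  tgt_mem := by
    rintro _ _ _ ⟨⟨p, a, q⟩, h, e⟩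
    exact ⟨q, 𝒜.tgt_mem _ _ _ h, (Prod.ext_iff.1 (Prod.ext_iff.1 e).2).2⟩
  initial := f '' 𝒜.initial
  final := f '' 𝒜.final
  initial_subset := Set.image_mono 𝒜.initial_subset
  final_subset := Set.image_mono 𝒜.final_subset

theorem mem_map_trans {f : Ω → Ω'} {𝒜 : FSAutomaton A Ω} {p' q' : Ω'} {a : A} :
    (p', a, q') ∈ (𝒜.map f).trans ↔ ∃ p q, (p, a, q) ∈ 𝒜.trans ∧ f p = p' ∧ f q = q' := by
  constructor
  · rintro ⟨⟨p, b, q⟩, h, e⟩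
    simp only [Prod.map_apply, id, Prod.mk.injEq] at e
    obtain ⟨rfl, rfl, rfl⟩ := e
    exact ⟨p, q, h, rfl, rfl⟩
  · rintro ⟨p, q, h, rfl, rfl⟩
    exact ⟨(p, a, q), h, rfl⟩

theorem hasPath_map (f : Ω → Ω') {𝒜 : FSAutomaton A Ω} {p q : Ω} {w : List A}
    (h : 𝒜.HasPath p w q) : (𝒜.map f).HasPath (f p) w (f q) :=
  h.map f (fun _ hp => Set.mem_image_of_mem f hp)
    (fun p _ q h => mem_map_trans.2 ⟨p, q, h, rfl, rfl⟩)

theorem exists_hasPath_of_map {f : Ω → Ω'} (hf : Function.Injective f) {𝒜 : FSAutomaton A Ω}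
    {p' q' : Ω'} {w : List A} (h : (𝒜.map f).HasPath p' w q') :
    ∃ p q, f p = p' ∧ f q = q' ∧ 𝒜.HasPath p w q := by
  induction h with
  | nil q' hq' =>
    obtain ⟨q, hq, rfl⟩ := hq'
    exact ⟨q, q, rfl, rfl, .nil q hq⟩
  | cons p' a q' w r' h _ ih =>
    obtain ⟨p, q, ht, rfl, rfl⟩ := mem_map_trans.1 h
    obtain ⟨q₁, r, e, rfl, hr⟩ := ih
    obtain rfl := hf e
    exact ⟨p, r, rfl, rfl, .cons _ _ _ _ _ ht hr⟩

theorem language_map {f : Ω → Ω'} (hf : Function.Injective f) (𝒜 : FSAutomaton A Ω) :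
    (𝒜.map f).language = 𝒜.language := by
  ext w
  constructor
  · rintro ⟨_, ⟨p, hp, rfl⟩, _, ⟨q, hq, rfl⟩, h⟩
    obtain ⟨p', q', e, e', h'⟩ := exists_hasPath_of_map hf h
    obtain rfl := hf e
    obtain rfl := hf e'
    exact ⟨_, hp, _, hq, h'⟩
  · rintro ⟨p, hp, q, hq, h⟩
    exact ⟨_, Set.mem_image_of_mem f hp, _, Set.mem_image_of_mem f hq, hasPath_map f h⟩

theorem mk_states_map {f : Ω → Ω'} (hf : Function.Injective f) (𝒜 : FSAutomaton A Ω) :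
    Cardinal.mk (𝒜.map f).states = Cardinal.mk 𝒜.states :=
  Cardinal.mk_image_eq hf

theorem mk_trans_map {f : Ω → Ω'} (hf : Function.Injective f) (𝒜 : FSAutomaton A Ω) :
    Cardinal.mk (𝒜.map f).trans = Cardinal.mk 𝒜.trans :=
  Cardinal.mk_image_eq (hf.prodMap (Function.injective_id.prodMap hf))

theorem mk_states_concat {𝒜₁ 𝒜₂ : FSAutomaton A Ω} {z : Ω} (hz : 𝒜₁.states ∩ 𝒜₂.states = {z}) :
    Cardinal.mk (𝒜₁.concat 𝒜₂).states + 1 = Cardinal.mk 𝒜₁.states + Cardinal.mk 𝒜₂.states := by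
  have h := Cardinal.mk_union_add_mk_inter (S := 𝒜₁.states) (T := 𝒜₂.states)
  rwa [hz, Cardinal.mk_singleton] at h

variable [PartialOrder A] {bar : A → A}

theorem map_isReflexiveInvolutive (f : Ω → Ω') {𝒜 : FSAutomaton A Ω}
    (h : 𝒜.IsReflexiveInvolutive bar) : (𝒜.map f).IsReflexiveInvolutive bar where
  loop := by
    rintro _ ⟨p, hp, rfl⟩ a
    exact mem_map_trans.2 ⟨p, p, h.loop p hp a, rfl, rfl⟩
  reverse := by
    intro _ a _ h'
    obtain ⟨p, q, ht, rfl, rfl⟩ := mem_map_trans.1 h'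
    exact mem_map_trans.2 ⟨q, p, h.reverse _ _ _ ht, rfl, rfl⟩
  up := by
    intro _ a b _ hab h'
    obtain ⟨p, q, ht, rfl, rfl⟩ := mem_map_trans.1 h'
    exact mem_map_trans.2 ⟨p, q, h.up _ _ _ _ hab ht, rfl, rfl⟩

/-! ### Concatenation of automata with one common state -/

section Concat

variable {𝒜₁ 𝒜₂ : FSAutomaton A Ω} {x y z : Ω}

theorem concat_isReflexiveInvolutive (h₁ : 𝒜₁.IsReflexiveInvolutive bar)
    (h₂ : 𝒜₂.IsReflexiveInvolutive bar) : (𝒜₁.concat 𝒜₂).IsReflexiveInvolutive bar where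
  loop p hp a := hp.imp (fun hp => h₁.loop p hp a) (fun hp => h₂.loop p hp a)
  reverse p a q h := h.imp (h₁.reverse p a q) (h₂.reverse p a q)
  up p a b q hab h := h.imp (h₁.up p a b q hab) (h₂.up p a b q hab)

/-- The common transitions are exactly the loops at `z`, one for each letter. -/
theorem mk_trans_concat (h₁ : 𝒜₁.IsReflexiveInvolutive bar) (h₂ : 𝒜₂.IsReflexiveInvolutive bar)
    (hz : 𝒜₁.states ∩ 𝒜₂.states = {z}) :
    Cardinal.mk (𝒜₁.concat 𝒜₂).trans + Cardinal.lift.{u} (Cardinal.mk A) =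
      Cardinal.mk 𝒜₁.trans + Cardinal.mk 𝒜₂.trans := by
  have h := Cardinal.mk_union_add_mk_inter (S := 𝒜₁.trans) (T := 𝒜₂.trans)
  have hz' : z ∈ 𝒜₁.states ∩ 𝒜₂.states := hz ▸ rfl
  have e : 𝒜₁.trans ∩ 𝒜₂.trans = Set.range fun a => (z, a, z) := by
    ext ⟨p, a, q⟩
    constructor
    · rintro ⟨ht₁, ht₂⟩
      obtain rfl : p = z := hz.subset ⟨𝒜₁.src_mem _ _ _ ht₁, 𝒜₂.src_mem _ _ _ ht₂⟩
      obtain rfl : q = p := hz.subset ⟨𝒜₁.tgt_mem _ _ _ ht₁, 𝒜₂.tgt_mem _ _ _ ht₂⟩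
      exact ⟨a, rfl⟩
    · rintro ⟨b, e⟩
      simp only [Prod.mk.injEq] at e
      obtain ⟨rfl, rfl, rfl⟩ := e
      exact ⟨h₁.loop _ hz'.1 _, h₂.loop _ hz'.2 _⟩
  have hc : Cardinal.mk (Set.range fun a : A => (z, a, z)) = Cardinal.lift.{u} (Cardinal.mk A) := by
    have := Cardinal.mk_range_eq_of_injective (f := fun a : A => (z, a, z))
      (fun a b h => (Prod.ext_iff.1 (Prod.ext_iff.1 h).2).1)
    rwa [Cardinal.lift_umax.{v, u}, Cardinal.lift_id'.{v, max u v}] at this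
  rw [e, hc] at h
  exact h

open Classical in
theorem language_concat (h₁ : 𝒜₁.IsReflexiveInvolutive bar)
    (h₂ : 𝒜₂.IsReflexiveInvolutive bar) (hx : 𝒜₁.initial = {x}) (hz₁ : 𝒜₁.final = {z})
    (hz₂ : 𝒜₂.initial = {z}) (hy : 𝒜₂.final = {y}) (hz : 𝒜₁.states ∩ 𝒜₂.states = {z}) :
    (𝒜₁.concat 𝒜₂).language = 𝒜₁.language * 𝒜₂.language := by
  have hz' : z ∈ 𝒜₁.states ∩ 𝒜₂.states := hz ▸ rfl
  have hx' : x ∈ 𝒜₁.states := 𝒜₁.initial_subset (hx ▸ rfl)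
  have hy' : y ∈ 𝒜₂.states := 𝒜₂.final_subset (hy ▸ rfl)
  ext w
  rw [mem_language_iff (𝒜 := 𝒜₁.concat 𝒜₂) hx hy, Language.mem_mul]
  constructor
  · intro h
    have hcut : ∀ p a q, (p, a, q) ∈ (𝒜₁.concat 𝒜₂).trans →
        p ∈ 𝒜₁.states \ {z} → q ∉ 𝒜₂.states \ {z} := by
      rintro p a q (ht | ht) ⟨hp, hpz⟩ ⟨hq, hqz⟩
      · exact hqz (hz.subset ⟨𝒜₁.tgt_mem _ _ _ ht, hq⟩)
      · exact hpz (hz.subset ⟨hp, 𝒜₂.src_mem _ _ _ ht⟩)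
    obtain ⟨u, v, r, rfl, hr, hr₁, hr₂, hu, hv⟩ := h.exists_split hcut
      (fun h => h.2 (hz.subset ⟨hx', h.1⟩)) (fun h => h.2 (hz.subset ⟨h.1, hy'⟩))
    obtain rfl : r = z := by
      by_contra hne
      rcases hr with hr | hr
      · exact hr₁ ⟨hr, hne⟩
      · exact hr₂ ⟨hr, hne⟩
    refine ⟨u, (mem_language_iff hx hz₁).2 ?_, v, (mem_language_iff hz₂ hy).2 ?_, rfl⟩
    -- The path from `x` to the common state may wander through `𝒜₂`. Collapsing `𝒜₂` to the common
    -- state sends its transitions to loops there, so the label is unchanged.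
    · have hid : ∀ p ∈ 𝒜₁.states, (if p ∈ 𝒜₁.states then p else r) = p := fun p hp => if_pos hp
      have hr : ∀ p ∈ 𝒜₂.states, (if p ∈ 𝒜₁.states then p else r) = r := fun p hp => by
        split_ifs with h
        exacts [hz.subset ⟨h, hp⟩, rfl]
      have := hu.map (M' := 𝒜₁.toTransitionSystem) (fun p => if p ∈ 𝒜₁.states then p else r)
        (fun p _ => by split_ifs with h; exacts [h, hz'.1]) (by
          rintro p a q (ht | ht)
          · simpa [𝒜₁.src_mem _ _ _ ht, 𝒜₁.tgt_mem _ _ _ ht] using ht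
          · simpa only [hr p (𝒜₂.src_mem _ _ _ ht), hr q (𝒜₂.tgt_mem _ _ _ ht)] using
              h₁.loop r hz'.1 a)
      simpa only [hid x hx', hid r hz'.1] using this
    · have hid : ∀ p ∈ 𝒜₂.states, (if p ∈ 𝒜₂.states then p else r) = p := fun p hp => if_pos hp
      have hr : ∀ p ∈ 𝒜₁.states, (if p ∈ 𝒜₂.states then p else r) = r := fun p hp => by
        split_ifs with h
        exacts [hz.subset ⟨hp, h⟩, rfl]
      have := hv.map (M' := 𝒜₂.toTransitionSystem) (fun p => if p ∈ 𝒜₂.states then p else r)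
        (fun p _ => by split_ifs with h; exacts [h, hz'.2]) (by
          rintro p a q (ht | ht)
          · simpa only [hr p (𝒜₁.src_mem _ _ _ ht), hr q (𝒜₁.tgt_mem _ _ _ ht)] using
              h₂.loop r hz'.2 a
          · simpa [𝒜₂.src_mem _ _ _ ht, 𝒜₂.tgt_mem _ _ _ ht] using ht)
      simpa only [hid y hy', hid r hz'.2] using this
  · rintro ⟨u, hu, v, hv, rfl⟩
    rw [mem_language_iff hx hz₁] at hu
    rw [mem_language_iff hz₂ hy] at hv
    exact HasPath.append
      (hu.map (M' := (𝒜₁.concat 𝒜₂).toTransitionSystem) id (fun _ => Or.inl) fun _ _ _ => Or.inl)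
      (hv.map (M' := (𝒜₁.concat 𝒜₂).toTransitionSystem) id (fun _ => Or.inr) fun _ _ _ => Or.inr)

end Concat

/-- Concatenation of automata with unrelated types of states: the final state of the first one is
identified with the initial state of the second one. -/
theorem exists_glue {Ω₁ Ω₂ : Type u} {𝒜₁ : FSAutomaton A Ω₁} {𝒜₂ : FSAutomaton A Ω₂}
    {x z₁ : Ω₁} {z₂ y : Ω₂}
    (hx : 𝒜₁.initial = {x}) (hz₁ : 𝒜₁.final = {z₁}) (hz₂ : 𝒜₂.initial = {z₂})
    (hy : 𝒜₂.final = {y})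
    (h₁ : 𝒜₁.IsReflexiveInvolutive bar) (h₂ : 𝒜₂.IsReflexiveInvolutive bar) :
    ∃ (ℬ : FSAutomaton A (Ω₁ ⊕ Ω₂)) (x' y' : Ω₁ ⊕ Ω₂), ℬ.initial = {x'} ∧ ℬ.final = {y'} ∧
      ℬ.IsReflexiveInvolutive bar ∧ ℬ.language = 𝒜₁.language * 𝒜₂.language ∧
      Cardinal.mk ℬ.states + 1 = Cardinal.mk 𝒜₁.states + Cardinal.mk 𝒜₂.states ∧
      Cardinal.mk ℬ.trans + Cardinal.lift.{u} (Cardinal.mk A) =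
        Cardinal.mk 𝒜₁.trans + Cardinal.mk 𝒜₂.trans := by
  classical
  let f : Ω₂ → Ω₁ ⊕ Ω₂ := fun p => if p = z₂ then Sum.inl z₁ else Sum.inr p
  have hf : Function.Injective f := by
    intro p q h
    simp only [f] at h
    split_ifs at h <;> simp_all
  have hfz : f z₂ = Sum.inl z₁ := if_pos rfl
  have hinl : Function.Injective (Sum.inl : Ω₁ → Ω₁ ⊕ Ω₂) := Sum.inl_injective
  have hi₁ : (𝒜₁.map Sum.inl).initial = {(Sum.inl x : Ω₁ ⊕ Ω₂)} := by simp [map, hx]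
  have hf₁ : (𝒜₁.map Sum.inl).final = {(Sum.inl z₁ : Ω₁ ⊕ Ω₂)} := by simp [map, hz₁]
  have hi₂ : (𝒜₂.map f).initial = {Sum.inl z₁} := by simp [map, hz₂, hfz]
  have hf₂ : (𝒜₂.map f).final = {f y} := by simp [map, hy]
  have hr₁ := map_isReflexiveInvolutive (Sum.inl : Ω₁ → Ω₁ ⊕ Ω₂) h₁
  have hr₂ := map_isReflexiveInvolutive f h₂
  have hz : (𝒜₁.map Sum.inl).states ∩ (𝒜₂.map f).states = {Sum.inl z₁} := by
    refine Set.Subset.antisymm ?_ (Set.singleton_subset_iff.2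
      ⟨FSAutomaton.final_subset _ (hf₁ ▸ rfl), FSAutomaton.initial_subset _ (hi₂ ▸ rfl)⟩)
    rintro _ ⟨⟨p, -, rfl⟩, q, -, e⟩
    simp only [f] at e
    split_ifs at e
    exact e.symm
  refine ⟨(𝒜₁.map Sum.inl).concat (𝒜₂.map f), Sum.inl x, f y, hi₁, hf₂,
    concat_isReflexiveInvolutive hr₁ hr₂, ?_, ?_, ?_⟩
  · rw [language_concat hr₁ hr₂ hi₁ hf₁ hi₂ hf₂ hz, language_map hinl, language_map hf]
  · rw [mk_states_concat hz, mk_states_map hinl, mk_states_map hf]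
  · rw [mk_trans_concat hr₁ hr₂ hz, mk_trans_map hinl, mk_trans_map hf]

/-! ### A final segment is accepted by a finite automaton -/

/-- The states are the residuals of `F`, with every transition compatible with left multiplication
by `a` and, backwards, by `bar a`. -/
theorem exists_finite_of_isFinalSegment [Finite A] (hbar : Function.Involutive bar)
    (hbar_mono : Monotone bar) {F : Language A} (hF : IsFinalSegment F) (hne : ∃ w, w ∈ F) :
    ∃ (Ω' : Type u) (ℬ : FSAutomaton A Ω') (x y : Ω'), Finite Ω' ∧ ℬ.initial = {x} ∧
      ℬ.final = {y} ∧ ℬ.IsReflexiveInvolutive bar ∧ ℬ.language = F := by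
  have := hF.finite_range_leftResidual.to_subtype
  -- The residuals live in the universe of `A`; numbering them moves the states to universe `u`.
  obtain ⟨n, ⟨e⟩⟩ := Finite.exists_equiv_fin (Set.range (leftResidual F))
  let R : ULift.{u} (Fin n) → Language A := fun i => (e.symm i.down).1
  have hR : ∀ i, IsFinalSegment (R i) := by
    intro i
    obtain ⟨u, hu⟩ := (e.symm i.down).2
    change IsFinalSegment (e.symm i.down).1
    rw [← hu]
    exact hF.leftResidual u
  have hRu : ∀ u, ∃ i, R i = leftResidual F u := fun u =>
    ⟨⟨e ⟨_, u, rfl⟩⟩, by simp [R]⟩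
  have hR_inj : Function.Injective R := fun i j h =>
    ULift.down_injective (e.symm.injective (Subtype.ext h))
  choose s hs using hRu
  obtain ⟨w₀, hw₀⟩ := hne
  let ℬ : FSAutomaton A (ULift.{u} (Fin n)) :=
    { states := Set.univ
      trans := {t | (∀ v ∈ R t.2.2, t.2.1 :: v ∈ R t.1) ∧ ∀ v ∈ R t.1, bar t.2.1 :: v ∈ R t.2.2}
      src_mem := fun _ _ _ _ => trivial
      tgt_mem := fun _ _ _ _ => trivial
      initial := {s []}
      final := {s w₀}
      initial_subset := fun _ _ => trivial
      final_subset := fun _ _ => trivial }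
  have hri : ℬ.IsReflexiveInvolutive bar :=
    { loop := fun p _ a => ⟨fun v hv => (hR p).append_left [a] hv,
        fun v hv => (hR p).append_left [bar a] hv⟩
      reverse := fun p a q h => ⟨h.2, fun v hv => by simpa only [hbar a] using h.1 v hv⟩
      up := fun p a b q hab h =>
        ⟨fun v hv => hR p _ _ (.cons hab (List.Sublist.refl v).sublistForall₂) (h.1 v hv),
          fun v hv => hR q _ _ (.cons (hbar_mono hab) (List.Sublist.refl v).sublistForall₂)
            (h.2 v hv)⟩ }
  refine ⟨_, ℬ, s [], s w₀, inferInstance, rfl, rfl, hri, ?_⟩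
  ext w
  rw [mem_language_iff (𝒜 := ℬ) rfl rfl]
  constructor
  · have key : ∀ {p w q}, ℬ.HasPath p w q → ∀ v ∈ R q, w ++ v ∈ R p := by
      intro p w q h
      induction h with
      | nil => exact fun v hv => hv
      | cons p a q w r h _ ih => exact fun v hv => h.1 _ (ih v hv)
    intro h
    have := key h [] (by rw [hs]; change w₀ ++ [] ∈ F; simpa using hw₀)
    rw [hs] at this
    simpa using show [] ++ (w ++ []) ∈ F from this
  · have hstep : ∀ u a, (s u, a, s (u ++ [a])) ∈ ℬ.trans := by
      intro u a
      refine ⟨fun v hv => ?_, fun v hv => ?_⟩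
      · dsimp only at hv ⊢
        rw [hs] at hv ⊢
        change u ++ a :: v ∈ F
        simpa using show (u ++ [a]) ++ v ∈ F from hv
      · dsimp only at hv ⊢
        rw [hs] at hv ⊢
        refine hF.sublist ?_ (show u ++ v ∈ F from hv)
        exact (List.sublist_append_left u [a]).append (List.sublist_cons_self _ _)
    have hpath : ∀ w u, ℬ.HasPath (s u) w (s (u ++ w)) := by
      intro w
      induction w with
      | nil => intro u; simpa using HasPath.nil (M := ℬ.toTransitionSystem) (s u) trivial
      | cons a w ih =>
        intro u
        exact .cons _ _ _ _ _ (hstep u a) (by simpa using ih (u ++ [a]))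
    intro hw
    -- The residual of `F` by any of its words is the set of all words, so a single final state
    -- suffices.
    have hend : s w = s w₀ := hR_inj <| by
      rw [hs, hs]
      ext v
      exact iff_of_true (hF.append_right v hw) (hF.append_right v hw₀)
    simpa only [List.nil_append, hend] using hpath w []

end FSAutomaton

/-! ### Decomposition of automata accepting a product -/

namespace FSAutomaton

open TransitionSystem

variable {A : Type v} {Ω : Type u}

theorem finite_trans {𝒜 : FSAutomaton A Ω} [Finite A] (h : 𝒜.states.Finite) : 𝒜.trans.Finite :=
  (h.prod (Set.finite_univ.prod h)).subset fun ⟨p, a, q⟩ ht =>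
    ⟨𝒜.src_mem p a q ht, trivial, 𝒜.tgt_mem p a q ht⟩

variable [PartialOrder A] {bar : A → A}

open Classical in
/-- A reflexive and involutive automaton accepting `F₁ * F₂` is cut by states `p` such that
all words from `x` to `p` are in `F₁` and all words from `p` to `y` are in `F₂`. Merging these
states gives automata accepting `F₁` and `F₂`. -/
theorem exists_decomposition {ℬ : FSAutomaton A Ω} {x y : Ω} (hx : ℬ.initial = {x})
    (hy : ℬ.final = {y}) (hri : ℬ.IsReflexiveInvolutive bar) {F₁ F₂ : Language A}
    (hF₁ : IsFinalSegment F₁) (hF₂ : IsFinalSegment F₂) (hne : ∃ w, w ∈ F₁ * F₂)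
    (hL : ℬ.language = F₁ * F₂) :
    ∃ (z x' y' : Ω) (ℬ₁ ℬ₂ : FSAutomaton A Ω),
      ℬ₁.initial = {x'} ∧ ℬ₁.final = {z} ∧ ℬ₂.initial = {z} ∧ ℬ₂.final = {y'} ∧
      ℬ₁.IsReflexiveInvolutive bar ∧ ℬ₂.IsReflexiveInvolutive bar ∧
      ℬ₁.language = F₁ ∧ ℬ₂.language = F₂ ∧ ℬ₁.states ∩ ℬ₂.states = {z} ∧
      ℬ₁.states ∪ ℬ₂.states ⊆ ℬ.states ∧
      (ℬ₁.states ∪ ℬ₂.states = ℬ.states → x' = x ∧ y' = y ∧ ℬ = ℬ₁.concat ℬ₂) := by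
  have hmem : ∀ {w}, ℬ.HasPath x w y ↔ w ∈ F₁ * F₂ := by
    intro w
    rw [← hL, mem_language_iff hx hy]
  have hxs : x ∈ ℬ.states := ℬ.initial_subset (hx ▸ rfl)
  have hys : y ∈ ℬ.states := ℬ.final_subset (hy ▸ rfl)
  obtain ⟨w₀, hw₀⟩ := hne
  obtain ⟨w₁, hw₁, w₂, hw₂, -⟩ := Language.mem_mul.1 hw₀
  let X : Set Ω := {p | ∃ u, ℬ.HasPath x u p ∧ u ∉ F₁}
  let Y : Set Ω := {p | ∃ v, ℬ.HasPath p v y ∧ v ∉ F₂}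
  have hX : ∀ {p u}, p ∉ X → ℬ.HasPath x u p → u ∈ F₁ := fun hp hu =>
    by_contra fun hu' => hp ⟨_, hu, hu'⟩
  have hY : ∀ {p v}, p ∉ Y → ℬ.HasPath p v y → v ∈ F₂ := fun hp hv =>
    by_contra fun hv' => hp ⟨_, hv, hv'⟩
  have hXY : ∀ p ∈ X, p ∉ Y := by
    rintro p ⟨u, hu, hu'⟩ ⟨v, hv, hv'⟩
    exact (hF₁.prefix_or_suffix hF₂ (hmem.1 (hu.append hv))).elim hu' hv'
  have hcut : ∀ p a q, (p, a, q) ∈ ℬ.trans → p ∈ X → q ∉ Y := by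
    rintro p a q ht ⟨u, hu, hu'⟩ ⟨v, hv, hv'⟩
    exact (hF₁.prefix_or_suffix_of_cons hF₂
      (hmem.1 (hu.append (.cons _ _ _ _ _ ht hv)))).elim hu' hv'
  have hXs : X ⊆ ℬ.states := fun p ⟨_, h, _⟩ => h.tgt_mem
  have hYs : Y ⊆ ℬ.states := fun p ⟨_, h, _⟩ => h.src_mem
  have hyX : y ∉ X := by
    rintro ⟨u, hu, hu'⟩
    obtain ⟨s, hs, t, -, rfl⟩ := Language.mem_mul.1 (hmem.1 hu)
    exact hu' (hF₁.append_right t hs)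
  have hxY : x ∉ Y := by
    rintro ⟨v, hv, hv'⟩
    obtain ⟨s, -, t, ht, rfl⟩ := Language.mem_mul.1 (hmem.1 hv)
    exact hv' (hF₂.append_left s ht)
  obtain ⟨-, -, z, -, hz, hzX, hzY, -, -⟩ := (hmem.2 hw₀).exists_split hcut hxY hyX
  let f : Set Ω → Ω → Ω := fun S p => if p ∈ S then p else z
  have f_of_mem : ∀ {S : Set Ω} {p}, p ∈ S → f S p = p := fun h => if_pos h
  have f_of_notMem : ∀ {S : Set Ω} {p}, p ∉ S → f S p = z := fun h => if_neg h
  have mem_of_f : ∀ {S : Set Ω} {p}, z ∉ S → f S p ∈ S → p ∈ S := by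
    intro S p hzS h
    by_contra hp
    exact hzS (f_of_notMem hp ▸ h)
  have f_states : ∀ {S : Set Ω}, S ⊆ ℬ.states → z ∉ S → (ℬ.map (f S)).states = insert z S := by
    intro S hS hzS
    ext p
    constructor
    · rintro ⟨q, hq, rfl⟩
      by_cases h : q ∈ S
      · rw [f_of_mem h]; exact Or.inr h
      · exact Or.inl (f_of_notMem h)
    · rintro (rfl | h)
      · exact ⟨p, hz, f_of_notMem hzS⟩
      · exact ⟨p, hS h, f_of_mem h⟩
  let ℬ₁ : FSAutomaton A Ω := { ℬ.map (f X) with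
    final := {z}, final_subset := Set.singleton_subset_iff.2 ⟨z, hz, f_of_notMem hzX⟩ }
  let ℬ₂ : FSAutomaton A Ω := { ℬ.map (f Y) with
    initial := {z}, initial_subset := Set.singleton_subset_iff.2 ⟨z, hz, f_of_notMem hzY⟩ }
  have hi₁ : ℬ₁.initial = {f X x} := by simp [ℬ₁, map, hx]
  have hf₂ : ℬ₂.final = {f Y y} := by simp [ℬ₂, map, hy]
  have hs₁ : ℬ₁.states = insert z X := f_states hXs hzX
  have hs₂ : ℬ₂.states = insert z Y := f_states hYs hzY
  have hri₁ : ℬ₁.IsReflexiveInvolutive bar := map_isReflexiveInvolutive (f X) hri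
  have hri₂ : ℬ₂.IsReflexiveInvolutive bar := map_isReflexiveInvolutive (f Y) hri
  have hz₁ : z ∈ ℬ₁.states := hs₁ ▸ Or.inl rfl
  have hz₂ : z ∈ ℬ₂.states := hs₂ ▸ Or.inl rfl
  have hL₁ : ∀ w ∈ ℬ₁.language, w ∈ F₁ := by
    -- Inside `X` the collapse is the identity, so the path lifts to `ℬ`, with `u` the word read so
    -- far. Once the lift leaves `X`, `u` is in `F₁`, and what follows is harmless.
    have key : ∀ {p' w q'}, ℬ₁.HasPath p' w q' → q' = z →
        ∀ p u, f X p = p' → ℬ.HasPath x u p → u ++ w ∈ F₁ := by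
      intro p' w q' h
      induction h with
      | nil q hq =>
        rintro rfl p u hp hu
        have : p ∉ X := fun h => hzX (by rw [f_of_mem h] at hp; exact hp ▸ h)
        exact hF₁.append_right _ (hX this hu)
      | cons p' a q' w r ht' _ ih =>
        rintro rfl p u rfl hu
        by_cases hp : p ∈ X
        · obtain ⟨p₀, q, ht, e, rfl⟩ := mem_map_trans.1 ht'
          rw [f_of_mem hp] at e
          have hp₀ : p₀ ∈ X := mem_of_f hzX (e ▸ hp)
          rw [f_of_mem hp₀] at e
          subst e
          simpa using ih rfl q (u ++ [a]) rfl (hu.append (.single ht))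
        · exact hF₁.append_right _ (hX hp hu)
    intro w hw
    exact key ((mem_language_iff hi₁ rfl).1 hw) rfl x [] rfl (.nil x hxs)
  have hL₂ : ∀ w ∈ ℬ₂.language, w ∈ F₂ := by
    -- Dual argument, read from the end of the path: it lifts backwards as long as it stays in `Y`.
    have key : ∀ {p' w q'}, ℬ₂.HasPath p' w q' → q' = f Y y →
        w ∈ F₂ ∨ p' ∈ Y ∧ ℬ.HasPath p' w y := by
      intro p' w q' h
      induction h with
      | nil q hq =>
        rintro rfl
        by_cases hp : y ∈ Y
        · rw [f_of_mem hp]; exact Or.inr ⟨hp, .nil y hys⟩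
        · exact Or.inl (hY hp (.nil y hys))
      | cons p' a q' w r ht' _ ih =>
        rintro rfl
        rcases ih rfl with hw | ⟨hq, hw⟩
        · exact Or.inl (hF₂.append_left [a] hw)
        · obtain ⟨p, q, ht, rfl, rfl⟩ := mem_map_trans.1 ht'
          rw [f_of_mem (mem_of_f hzY hq)] at hw
          have hw' := HasPath.cons _ _ _ _ _ ht hw
          by_cases hp : p ∈ Y
          · rw [f_of_mem hp]; exact Or.inr ⟨hp, hw'⟩
          · exact Or.inl (hY hp hw')
    intro w hw
    exact (key ((mem_language_iff rfl hf₂).1 hw) rfl).elim id fun h => absurd h.1 hzY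
  have hprod : ∀ w ∈ F₁ * F₂, w ∈ ℬ₁.language * ℬ₂.language := by
    intro w hw
    obtain ⟨u, v, r, rfl, -, hrX, hrY, hu, hv⟩ := (hmem.2 hw).exists_split hcut hxY hyX
    refine Language.append_mem_mul ((mem_language_iff hi₁ rfl).2 ?_)
      ((mem_language_iff rfl hf₂).2 ?_)
    · exact (f_of_notMem hrX) ▸ (hasPath_map (f X) hu : ℬ₁.HasPath _ _ _)
    · exact (f_of_notMem hrY) ▸ (hasPath_map (f Y) hv : ℬ₂.HasPath _ _ _)
  obtain ⟨hl₁, hl₂⟩ := Language.eq_of_le_of_mul_le ⟨w₁, hw₁⟩ ⟨w₂, hw₂⟩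
    (fun u v hu => (mem_language_iff hi₁ rfl).2
      (((mem_language_iff hi₁ rfl).1 hu).append (hri₁.loops hz₁ v)))
    (fun u v hv => (mem_language_iff rfl hf₂).2
      ((hri₂.loops hz₂ u).append ((mem_language_iff rfl hf₂).1 hv))) hL₁ hL₂ hprod
  have hinter : ℬ₁.states ∩ ℬ₂.states = {z} := by
    rw [hs₁, hs₂]
    ext p
    constructor
    · rintro ⟨hp | hp, hp' | hp'⟩
      exacts [hp, hp, hp', absurd hp' (hXY p hp)]
    · rintro rfl
      exact ⟨Or.inl rfl, Or.inl rfl⟩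
  refine ⟨z, f X x, f Y y, ℬ₁, ℬ₂, hi₁, rfl, rfl, hf₂, hri₁, hri₂, hl₁, hl₂, hinter, ?_, ?_⟩
  · rw [hs₁, hs₂]
    exact Set.union_subset (Set.insert_subset hz hXs) (Set.insert_subset hz hYs)
  · intro hun
    -- When no state is lost, `z` is the only state outside `X ∪ Y`, so both collapses fix the
    -- states of their own half.
    have hZ : ∀ {p}, p ∈ ℬ.states → p ∉ X → p ∉ Y → p = z := by
      intro p hp hpX hpY
      rw [← hun, hs₁, hs₂] at hp
      rcases hp with (h | h) | (h | h)
      exacts [h, absurd h hpX, h, absurd h hpY]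
    have hfX : ∀ {p}, p ∈ ℬ.states → p ∉ Y → f X p = p := by
      intro p hp hpY
      by_cases hpX : p ∈ X
      · exact f_of_mem hpX
      · rw [f_of_notMem hpX, hZ hp hpX hpY]
    have hfY : ∀ {p}, p ∈ ℬ.states → p ∉ X → f Y p = p := by
      intro p hp hpX
      by_cases hpY : p ∈ Y
      · exact f_of_mem hpY
      · rw [f_of_notMem hpY, hZ hp hpX hpY]
    refine ⟨hfX hxs hxY, hfY hys hyX, FSAutomaton.ext hun.symm ?_ ?_ ?_⟩
    · ext ⟨p, a, q⟩
      constructor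
      · intro ht
        have hp := ℬ.src_mem _ _ _ ht
        have hq := ℬ.tgt_mem _ _ _ ht
        -- By `reverse`, no transition goes from `Y` to `X` either, so each one lies in a single
        -- half.
        by_cases h : p ∈ Y ∨ q ∈ Y
        · have : p ∉ X ∧ q ∉ X := by
            rcases h with h | h
            · exact ⟨fun hp => hXY p hp h, fun hq => hcut _ _ _ (hri.reverse _ _ _ ht) hq h⟩
            · exact ⟨fun hp => hcut _ _ _ ht hp h, fun hq => hXY q hq h⟩
          exact Or.inr (mem_map_trans.2 ⟨p, q, ht, hfY hp this.1, hfY hq this.2⟩)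
        · rw [not_or] at h
          exact Or.inl (mem_map_trans.2 ⟨p, q, ht, hfX hp h.1, hfX hq h.2⟩)
      · rintro (ht' | ht')
        · obtain ⟨p, q, ht, rfl, rfl⟩ := mem_map_trans.1 ht'
          have hp := ℬ.src_mem _ _ _ ht
          have hq := ℬ.tgt_mem _ _ _ ht
          by_cases h : p ∈ X ∨ q ∈ X
          · have : p ∉ Y ∧ q ∉ Y := by
              rcases h with h | h
              · exact ⟨hXY p h, hcut _ _ _ ht h⟩
              · exact ⟨hcut _ _ _ (hri.reverse _ _ _ ht) h, hXY q h⟩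
            rwa [hfX hp this.1, hfX hq this.2]
          -- Both ends collapse: the image is a loop at `z`, present in `ℬ` by reflexivity.
          · rw [not_or] at h
            rw [f_of_notMem h.1, f_of_notMem h.2]
            exact hri.loop z hz a
        · obtain ⟨p, q, ht, rfl, rfl⟩ := mem_map_trans.1 ht'
          have hp := ℬ.src_mem _ _ _ ht
          have hq := ℬ.tgt_mem _ _ _ ht
          by_cases h : p ∈ Y ∨ q ∈ Y
          · have : p ∉ X ∧ q ∉ X := by
              rcases h with h | h
              · exact ⟨fun hp => hXY p hp h, fun hq => hcut _ _ _ (hri.reverse _ _ _ ht) hq h⟩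
              · exact ⟨fun hp => hcut _ _ _ ht hp h, fun hq => hXY q hq h⟩
            rwa [hfY hp this.1, hfY hq this.2]
          · rw [not_or] at h
            rw [f_of_notMem h.1, f_of_notMem h.2]
            exact hri.loop z hz a
    · exact hx.trans (hfX hxs hxY ▸ hi₁.symm)
    · exact hy.trans (hfY hys hyX ▸ hf₂.symm)

/-! ### Minmax automata -/

section Minmax

variable {𝒜 𝒜₁ 𝒜₂ : FSAutomaton A Ω} {x y z : Ω}

theorem IsMinmax.finite_states [Finite A] (hbar : Function.Involutive bar)
    (hbar_mono : Monotone bar) (h : 𝒜.IsMinmax bar) {F : Language A} (hF : IsFinalSegment F)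
    (hne : ∃ w, w ∈ F) (hL : 𝒜.language = F) : 𝒜.states.Finite := by
  obtain ⟨Ω', ℬ, x', y', _, hx', hy', hri, hl⟩ :=
    exists_finite_of_isFinalSegment.{u} hbar hbar_mono hF hne
  rw [← Set.finite_coe_iff, ← Cardinal.lt_aleph0_iff_finite]
  exact (h.states_le Ω' ℬ x' y' hx' hy' hri (hl.trans hL.symm)).trans_lt
    (Cardinal.lt_aleph0_iff_finite.2 inferInstance)

/-- A competitor of `𝒜₁` glued to `𝒜₂` is a competitor of the concatenation; the finite contribution
of `𝒜₂` then cancels. -/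
theorem IsMinmax.of_concat_left [Finite A] (h : (𝒜₁.concat 𝒜₂).IsMinmax bar)
    (hfin : 𝒜₂.states.Finite)
    (hx : 𝒜₁.initial = {x}) (hz₁ : 𝒜₁.final = {z}) (hz₂ : 𝒜₂.initial = {z})
    (hy : 𝒜₂.final = {y}) (hz : 𝒜₁.states ∩ 𝒜₂.states = {z})
    (hri₁ : 𝒜₁.IsReflexiveInvolutive bar) (hri₂ : 𝒜₂.IsReflexiveInvolutive bar) :
    𝒜₁.IsMinmax bar := by
  have hfs := Cardinal.lt_aleph0_iff_set_finite.2 hfin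
  have hft := Cardinal.lt_aleph0_iff_set_finite.2 (finite_trans hfin)
  have hL := language_concat hri₁ hri₂ hx hz₁ hz₂ hy hz
  have hs := mk_states_concat hz
  have ht := mk_trans_concat hri₁ hri₂ hz
  refine ⟨⟨x, hx⟩, ⟨z, hz₁⟩, hri₁, fun Ω' ℬ x' y' hx' hy' hri hl => ?_,
    fun Ω' ℬ x' y' hx' hy' hri hl hc => ?_⟩ <;>
  obtain ⟨𝒢, x'', y'', hx'', hy'', hri', hl', hs', ht'⟩ := exists_glue hx' hy' hz₂ hy hri hri₂ <;>
  rw [hl, ← hL] at hl'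
  · rw [← Cardinal.add_le_add_iff_of_lt_aleph0 hfs, ← hs, ← hs']
    exact add_le_add_left (h.states_le _ 𝒢 x'' y'' hx'' hy'' hri' hl') 1
  · rw [← Cardinal.add_le_add_iff_of_lt_aleph0 hft, ← ht, ← ht']
    refine add_le_add_left (h.trans_ge _ 𝒢 x'' y'' hx'' hy'' hri' hl' ?_) _
    rw [← Cardinal.add_one_inj, hs, hs', hc]

theorem IsMinmax.of_concat_right [Finite A] (h : (𝒜₁.concat 𝒜₂).IsMinmax bar)
    (hfin : 𝒜₁.states.Finite)
    (hx : 𝒜₁.initial = {x}) (hz₁ : 𝒜₁.final = {z}) (hz₂ : 𝒜₂.initial = {z})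
    (hy : 𝒜₂.final = {y}) (hz : 𝒜₁.states ∩ 𝒜₂.states = {z})
    (hri₁ : 𝒜₁.IsReflexiveInvolutive bar) (hri₂ : 𝒜₂.IsReflexiveInvolutive bar) :
    𝒜₂.IsMinmax bar := by
  have hfs := Cardinal.lt_aleph0_iff_set_finite.2 hfin
  have hft := Cardinal.lt_aleph0_iff_set_finite.2 (finite_trans hfin)
  have hL := language_concat hri₁ hri₂ hx hz₁ hz₂ hy hz
  have hs := mk_states_concat hz
  have ht := mk_trans_concat hri₁ hri₂ hz
  refine ⟨⟨z, hz₂⟩, ⟨y, hy⟩, hri₂, fun Ω' ℬ x' y' hx' hy' hri hl => ?_,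
    fun Ω' ℬ x' y' hx' hy' hri hl hc => ?_⟩ <;>
  obtain ⟨𝒢, x'', y'', hx'', hy'', hri', hl', hs', ht'⟩ := exists_glue hx hz₁ hx' hy' hri₁ hri <;>
  rw [hl, ← hL] at hl'
  · rw [← Cardinal.add_le_add_iff_of_lt_aleph0 hfs, add_comm, ← hs,
      add_comm (Cardinal.mk ℬ.states), ← hs']
    exact add_le_add_left (h.states_le _ 𝒢 x'' y'' hx'' hy'' hri' hl') 1
  · rw [← Cardinal.add_le_add_iff_of_lt_aleph0 hft, add_comm, ← ht',
      add_comm (Cardinal.mk 𝒜₂.trans), ← ht]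
    refine add_le_add_left (h.trans_ge _ 𝒢 x'' y'' hx'' hy'' hri' hl' ?_) _
    rw [← Cardinal.add_one_inj, hs, hs', hc]

/-- A competitor of the concatenation contains two pieces accepting the same factors, each at least
as large as the corresponding minmax automaton. -/
theorem IsMinmax.concat [Finite A] (h₁ : 𝒜₁.IsMinmax bar) (h₂ : 𝒜₂.IsMinmax bar)
    (hF₁ : IsFinalSegment 𝒜₁.language) (hF₂ : IsFinalSegment 𝒜₂.language)
    (hne : ∃ w, w ∈ 𝒜₁.language * 𝒜₂.language)
    (hfin₁ : 𝒜₁.states.Finite) (hfin₂ : 𝒜₂.states.Finite)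
    (hx : 𝒜₁.initial = {x}) (hz₁ : 𝒜₁.final = {z}) (hz₂ : 𝒜₂.initial = {z})
    (hy : 𝒜₂.final = {y}) (hz : 𝒜₁.states ∩ 𝒜₂.states = {z}) :
    (𝒜₁.concat 𝒜₂).IsMinmax bar := by
  have hL := language_concat h₁.refl_inv h₂.refl_inv hx hz₁ hz₂ hy hz
  have hs := mk_states_concat hz
  have ht := mk_trans_concat h₁.refl_inv h₂.refl_inv hz
  refine ⟨⟨x, hx⟩, ⟨y, hy⟩, concat_isReflexiveInvolutive h₁.refl_inv h₂.refl_inv,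
    fun Ω' ℬ x' y' hx' hy' hri hl => ?_, fun Ω' ℬ x' y' hx' hy' hri hl hc => ?_⟩ <;>
  obtain ⟨z', x'', y'', ℬ₁, ℬ₂, hi₁, hf₁, hi₂, hf₂, hri₁, hri₂, hl₁, hl₂, hz', hsub, heq⟩ :=
    exists_decomposition hx' hy' hri hF₁ hF₂ hne (hl.trans hL) <;>
  have hle₁ := h₁.states_le _ ℬ₁ _ _ hi₁ hf₁ hri₁ hl₁ <;>
  have hle₂ := h₂.states_le _ ℬ₂ _ _ hi₂ hf₂ hri₂ hl₂ <;>
  have hs' := mk_states_concat hz'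
  · refine le_trans ?_ (Cardinal.mk_le_mk_of_subset hsub)
    rw [← Cardinal.add_one_le_add_one_iff, hs]
    exact (add_le_add hle₁ hle₂).trans hs'.symm.le
  · have hfin : ℬ.states.Finite := by
      rw [← Cardinal.lt_aleph0_iff_set_finite, ← hc, Cardinal.lt_aleph0_iff_set_finite]
      exact hfin₁.union hfin₂
    have hfin' := hfin.subset hsub
    have hn₁ := hfin'.subset Set.subset_union_left
    have hn₂ := hfin'.subset Set.subset_union_right
    have hcard := Cardinal.mk_le_mk_of_subset hsub
    change Cardinal.mk ↑(ℬ₁.states ∪ ℬ₂.states) + 1 = _ at hs'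
    have hfin'' : (𝒜₁.concat 𝒜₂).states.Finite := hfin₁.union hfin₂
    rw [← Set.cast_ncard hfin₁, ← Set.cast_ncard hn₁] at hle₁
    rw [← Set.cast_ncard hfin₂, ← Set.cast_ncard hn₂] at hle₂
    rw [← Set.cast_ncard hfin'', ← Set.cast_ncard hfin₁, ← Set.cast_ncard hfin₂] at hs
    rw [← Set.cast_ncard hfin', ← Set.cast_ncard hn₁, ← Set.cast_ncard hn₂] at hs'
    rw [← Set.cast_ncard hfin'', ← Set.cast_ncard hfin] at hc
    rw [← Set.cast_ncard hfin, ← Set.cast_ncard hfin'] at hcard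
    norm_cast at hle₁ hle₂ hs hs' hc hcard
    -- Equality of the totals squeezes all the inequalities: `ℬ` is the concatenation of its pieces,
    -- and each piece has as many states as its counterpart, so transitions can be compared factor
    -- by factor.
    obtain ⟨-, -, rfl⟩ := heq (Set.eq_of_subset_of_ncard_le hsub (by omega) hfin)
    have ht' := mk_trans_concat hri₁ hri₂ hz'
    have hA : Cardinal.lift.{u} (Cardinal.mk A) < Cardinal.aleph0 := by
      simp
    rw [← Cardinal.add_le_add_iff_of_lt_aleph0 hA, ht, ht']
    refine add_le_add (h₁.trans_ge _ ℬ₁ _ _ hi₁ hf₁ hri₁ hl₁ ?_)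
      (h₂.trans_ge _ ℬ₂ _ _ hi₂ hf₂ hri₂ hl₂ ?_)
    · rw [← Set.cast_ncard hfin₁, ← Set.cast_ncard hn₁]
      norm_cast
      omega
    · rw [← Set.cast_ncard hfin₂, ← Set.cast_ncard hn₂]
      norm_cast
      omega

end Minmax

end FSAutomaton

theorem mainTheorem10 {A : Type v} [PartialOrder A] [Finite A]
    (bar : A → A) (hbar : Function.Involutive bar) (hbar_mono : Monotone bar)
    (F F₁ F₂ : Language A) (hF : IsFinalSegment F) (hF_ne : ∃ w, w ∈ F)
    (hF₁ : IsFinalSegment F₁) (hF₂ : IsFinalSegment F₂) (hfac : F = F₁ * F₂)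
    {Ω : Type u} (𝒜 : FSAutomaton A Ω) (x y : Ω)
    (hx : 𝒜.initial = {x}) (hy : 𝒜.final = {y}) (hacc : 𝒜.language = F) :
    𝒜.IsMinmax bar ↔
      ∃ (z : Ω) (𝒜₁ 𝒜₂ : FSAutomaton A Ω),
        𝒜₁.initial = {x} ∧ 𝒜₁.final = {z} ∧ 𝒜₂.initial = {z} ∧ 𝒜₂.final = {y} ∧
        𝒜₁.states ∩ 𝒜₂.states = {z} ∧
        𝒜₁.language = F₁ ∧ 𝒜₂.language = F₂ ∧
        𝒜₁.IsMinmax bar ∧ 𝒜₂.IsMinmax bar ∧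
        𝒜 = 𝒜₁.concat 𝒜₂ := by
  constructor
  · intro h
    have hfin := h.finite_states hbar hbar_mono hF hF_ne hacc
    obtain ⟨z, x', y', 𝒜₁, 𝒜₂, hi₁, hf₁, hi₂, hf₂, hri₁, hri₂, hl₁, hl₂, hz, hsub, heq⟩ :=
      FSAutomaton.exists_decomposition hx hy h.refl_inv hF₁ hF₂ (hfac ▸ hF_ne) (hacc.trans hfac)
    -- The concatenated pieces again accept `F`, so minimality of `𝒜` forbids losing a state.
    have hle := h.states_le _ (𝒜₁.concat 𝒜₂) x' y' hi₁ hf₂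
      (FSAutomaton.concat_isReflexiveInvolutive hri₁ hri₂)
      (by rw [FSAutomaton.language_concat hri₁ hri₂ hi₁ hf₁ hi₂ hf₂ hz, hl₁, hl₂, hacc, hfac])
    change Cardinal.mk 𝒜.states ≤ Cardinal.mk ↑(𝒜₁.states ∪ 𝒜₂.states) at hle
    rw [← Set.cast_ncard hfin, ← Set.cast_ncard (hfin.subset hsub), Nat.cast_le] at hle
    obtain ⟨rfl, rfl, rfl⟩ := heq (Set.eq_of_subset_of_ncard_le hsub hle hfin)
    exact ⟨z, 𝒜₁, 𝒜₂, hi₁, hf₁, hi₂, hf₂, hz, hl₁, hl₂,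
      h.of_concat_left (hfin.subset Set.subset_union_right) hi₁ hf₁ hi₂ hf₂ hz hri₁ hri₂,
      h.of_concat_right (hfin.subset Set.subset_union_left) hi₁ hf₁ hi₂ hf₂ hz hri₁ hri₂, rfl⟩
  · rintro ⟨z, 𝒜₁, 𝒜₂, hi₁, hf₁, hi₂, hf₂, hz, hl₁, hl₂, h₁, h₂, rfl⟩
    rw [hfac] at hF_ne
    obtain ⟨w, hw⟩ := hF_ne
    obtain ⟨w₁, hw₁, w₂, hw₂, -⟩ := Language.mem_mul.1 hw
    exact h₁.concat h₂ (hl₁ ▸ hF₁) (hl₂ ▸ hF₂) ⟨w, hl₁ ▸ hl₂ ▸ hw⟩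
      (h₁.finite_states hbar hbar_mono hF₁ ⟨w₁, hw₁⟩ hl₁)
      (h₂.finite_states hbar hbar_mono hF₂ ⟨w₂, hw₂⟩ hl₂) hi₁ hf₁ hi₂ hf₂ hz
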